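/- **Theorem (Access Theorem).** A *gap data structure* is any data structure for a set of gaps, each of which is given by its right boundary and its size. It supports locating the gap into which an element falls, changing the size of a gap by one, removing a gap, and adding a gap (a splay tree or a globally biased tree are examples). Its running times are arbitrary. A *lazy search tree* over a gap data structure $D$ stores its elements in gaps $\Delta_1\le\dots\le\Delta_m$, kept in $D$, and each gap as a sorted sequence of unordered intervals. - An access to an element $x$ locates the gap of $x$ in $D$. If the right boundary of this gap was created by an earlier access to $x$, then $x$ is returned at once. - Otherwise the interval containing $x$ is found by binary search and partitioned around $x$. Each of the two parts is split at its median, and its half next to $x$ is split at its median once more. The gap is removed from $D$, the two gaps into which $x$ divides it (the left one ending with $x$, the right one omitted if empty) are added to $D$, and intervals in the two gaps are merged by the merging rule: an interval on the left side of a gap, not the rightmost such interval, is merged with its right neighbour if the number of elements of the gap to its left is at least the total size of the two intervals, and symmetrically on the right side. - An insertion locates the gap in $D$, puts the element into the correct interval of this gap, and increases the size of the gap in $D$ by one. There is an absolute constant $C$ such that the following holds for every totally ordered universe of elements and every gap data structure $D$. Let a lazy search tree over $D$ be constructed on a finite multiset $S$ and then undergo any (possibly empty) sequence of insertions and of accesses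 to elements present. Let $x_1,\dots,x_k$ be any sequence of accesses to elements it then contains, and let $R$ be the set of all $j$ such that $x_j$ was accessed before, that is, $x_j=x_i$ for some $i<j$ or $x_j$ was accessed before the sequence started. Then $$\sum_{j\in R} t_{\mathrm{LST}}(j)\;\le\;\sum_{j\in R} t_{D}(j)+C\,k .$$ Here $t_{\mathrm{LST}}(j)$ is the number of steps the lazy search tree spends on the $j$-th access. The number $t_D(j)$ is the number of steps $D$ by itself spends on the $j$-th access when it serves the same sequence of operations: an access to $x$ locates the gap of $x$ and, if $x$ was not accessed before, makes $x$ a boundary by replacing its gap by the two resulting gaps. Thus, disregarding the first access to each element, lazy search trees perform any access sequence in time no more than an additive linear term from the gap data structure. -/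

import Mathlib

universe u v w

/-! Step counting. -/

/-- The result of a computation together with the number of elementary steps (comparisons, pointer
and array operations) it performed. -/
structure Timed (β : Type u) where
  val : β
  time : ℕ

namespace Timed

def ret {β : Type u} (b : β) : Timed β := ⟨b, 0⟩

/-- Run `m`, then `f` on its result; the times add up. -/
def bind {β : Type u} {γ : Type v} (m : Timed β) (f : β → Timed γ) : Timed γ :=
  ⟨(f m.val).val, m.time + (f m.val).time⟩

/-- Spend `c` elementary steps, then run `m`. -/
def tick {β : Type u} (c : ℕ) (m : Timed β) : Timed β := ⟨m.val, c + m.time⟩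

end Timed

infixr:55 " ⇝ " => Timed.bind

/-! The gap data structure. -/

/-- A data structure for the ordered set of gaps. A gap is represented by its right boundary, an
element of `WithTop α` (`⊤` if the gap is unbounded to the right): it holds the elements that are
at most this boundary and larger than the boundary of the preceding gap. An implementation has a
type of internal states and realizes the operations with arbitrary running times; an operation
may rearrange the state (as a self-adjusting tree does). -/
structure GapDS (α : Type u) [LinearOrder α] where
  State : Type v
  /-- The size of the gap with the given right boundary; `0` if there is no such gap. -/
  size : State → WithTop α → ℕ
  empty : State
  /-- Operation 1: find the gap into which an element falls. -/
  locate : α → State → Timed (State × Option (WithTop α))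
  /-- Operation 2: increase or decrease the size of a gap by one. -/
  increment : WithTop α → State → Timed State
  decrement : WithTop α → State → Timed State
  /-- Operation 3: remove a gap. -/
  remove : WithTop α → State → Timed State
  /-- Operation 4: add a gap of the given size. -/
  add : WithTop α → ℕ → State → Timed State
  size_empty : ∀ b, size empty b = 0
  size_locate : ∀ x s, size (locate x s).val.1 = size s
  locate_eq_some : ∀ x s b, (locate x s).val.2 = some b ↔
    IsLeast {c : WithTop α | size s c ≠ 0 ∧ (x : WithTop α) ≤ c} b
  size_increment : ∀ b s, size s b ≠ 0 →
    size (increment b s).val = Function.update (size s) b (size s b + 1)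
  size_decrement : ∀ b s, 1 < size s b →
    size (decrement b s).val = Function.update (size s) b (size s b - 1)
  size_remove : ∀ b s, size s b ≠ 0 →
    size (remove b s).val = Function.update (size s) b 0
  size_add : ∀ b k s, size s b = 0 → 0 < k →
    size (add b k s).val = Function.update (size s) b k

/-! Splay trees. -/

inductive STree (κ : Type u) where
  | leaf
  | node (l : STree κ) (key : κ) (weight : ℕ) (r : STree κ)

namespace STree

variable {κ : Type u} [LinearOrder κ]

def toList : STree κ → List (κ × ℕ)
  | leaf => []
  | node l a m r => toList l ++ (a, m) :: toList r

/-- Splaying: the last node on the search path for `b` is moved to the root by zig-zig and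
zig-zag steps, where the path is divided into pairs of edges from the root downwards, and a final
zig step at its lower end if an edge is left over. -/
def splay (b : κ) : STree κ → STree κ
  | leaf => leaf
  | node l a m r =>
    if b < a then
      match l with
      | leaf => node leaf a m r
      | node ll c k lr =>
        if b < c then
          match splay b ll with
          | leaf => node ll c k (node lr a m r)
          | node x d i y => node x d i (node y c k (node lr a m r))
        else if c < b then
          match splay b lr with
          | leaf => node ll c k (node lr a m r)
          | node x d i y => node (node ll c k x) d i (node y a m r)
        else node ll c k (node lr a m r)
    else if a < b then
      match r with
      | leaf => node l a m leaf
      | node rl c k rr =>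
        if c < b then
          match splay b rr with
          | leaf => node (node l a m rl) c k rr
          | node x d i y => node (node (node l a m rl) c k x) d i y
        else if b < c then
          match splay b rl with
          | leaf => node (node l a m rl) c k rr
          | node x d i y => node (node l a m x) d i (node y c k rr)
        else node (node l a m rl) c k rr
    else node l a m r

theorem toList_splay (b : κ) (t : STree κ) : toList (splay b t) = toList t := by
  fun_induction splay b t <;> simp_all [toList] <;> (rename_i ih; rw [← ih]; simp)

/-- The number of nodes visited by a search for `b` (counting the empty tree at its end). -/
def cost (b : κ) : STree κ → ℕ
  | leaf => 1
  | node l a _ r => if b < a then cost b l + 1 else if a < b then cost b r + 1 else 1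

/-- The least key that is at least `b`, by a search in the tree. -/
def ceil (b : κ) : STree κ → Option κ
  | leaf => none
  | node l a _ r =>
    if b < a then some ((ceil b l).getD a) else if a < b then ceil b r else some a

/-- Change of the weight of the key `b`. -/
def modify (b : κ) (f : ℕ → ℕ) : STree κ → STree κ
  | leaf => leaf
  | node l a m r =>
    if b < a then node (modify b f l) a m r
    else if a < b then node l a m (modify b f r)
    else node l a (f m) r

/-- Insertion at a leaf. -/
def insertLeaf (b : κ) (k : ℕ) : STree κ → STree κ
  | leaf => node leaf b k leaf
  | node l a m r =>
    if b < a then node (insertLeaf b k l) a m r else node l a m (insertLeaf b k r)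

/-- Hang the tree `r` below the last node of a tree. -/
def hang (r : STree κ) : STree κ → STree κ
  | leaf => r
  | node l a m r' => node l a m (hang r r')

/-- Deletion of the key `b`: the subtrees `l`, `r` of its node are joined by splaying the
largest node of `l` to the root, where `r` becomes its right subtree. -/
def delete (b : κ) : STree κ → STree κ
  | leaf => leaf
  | node l a m r =>
    if b < a then node (delete b l) a m r
    else if a < b then node l a m (delete b r)
    else hang r (splay b l)

/-- The number of nodes visited by `delete`. -/
def deleteCost (b : κ) : STree κ → ℕ
  | leaf => 1
  | node l a _ r =>
    if b < a then deleteCost b l + 1 else if a < b then deleteCost b r + 1 else cost b l + 1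

/-- The total weight of the nodes with key `b`. -/
def weight (t : STree κ) (b : κ) : ℕ := ((toList t).map fun p => if p.1 = b then p.2 else 0).sum

/-- Search tree order, and no node has weight `0`. -/
def Good (t : STree κ) : Prop :=
  (toList t).Pairwise (fun p q => p.1 < q.1) ∧ ∀ p ∈ toList t, 0 < p.2

theorem good_splay (b : κ) {t : STree κ} (h : Good t) : Good (splay b t) := by
  simpa [Good, toList_splay] using h

theorem weight_splay (b : κ) (t : STree κ) : weight (splay b t) = weight t := by
  funext c; simp [weight, toList_splay]

theorem toList_hang {κ : Type u} (r t : STree κ) : toList (hang r t) = toList t ++ toList r := by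
  induction t <;> simp_all [hang, toList]

theorem toList_delete (b : κ) (t : STree κ)
    (h : (toList t).Pairwise (fun p q => p.1 < q.1)) :
    toList (delete b t) = (toList t).filter (·.1 ≠ b) := by
  induction t with
  | leaf => rfl
  | node l a m r ihl ihr =>
    simp only [toList, List.pairwise_append, List.pairwise_cons, List.mem_cons, forall_eq_or_imp]
      at h
    obtain ⟨hl, ⟨har, hr⟩, hlr⟩ := h
    have key : ∀ (L : List (κ × ℕ)), (∀ p ∈ L, p.1 ≠ b) → L.filter (·.1 ≠ b) = L := by
      intro L hL; simpa [List.filter_eq_self] using hL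
    unfold delete
    split_ifs with h1 h2
    · simp only [toList, ihl hl, List.filter_append, List.filter_cons]
      rw [key (toList r) (fun p hp => (h1.trans (har p hp)).ne')]
      simp [h1.ne']
    · simp only [toList, ihr hr, List.filter_append, List.filter_cons]
      rw [key (toList l) (fun p hp => ((hlr p hp).1.trans h2).ne)]
      simp [h2.ne]
    · obtain rfl : a = b := le_antisymm (not_lt.1 h1) (not_lt.1 h2)
      simp only [toList, toList_hang, toList_splay, List.filter_append, List.filter_cons]
      rw [key (toList l) (fun p hp => (hlr p hp).1.ne), key (toList r) (fun p hp => (har p hp).ne')]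
      simp

theorem toList_modify (b : κ) (f : ℕ → ℕ) (t : STree κ)
    (h : (toList t).Pairwise (fun p q => p.1 < q.1)) :
    toList (modify b f t) = (toList t).map fun p => (p.1, if p.1 = b then f p.2 else p.2) := by
  induction t with
  | leaf => rfl
  | node l a m r ihl ihr =>
    simp only [toList, List.pairwise_append, List.pairwise_cons, List.mem_cons, forall_eq_or_imp]
      at h
    obtain ⟨hl, ⟨har, hr⟩, hlr⟩ := h
    have key : ∀ (L : List (κ × ℕ)), (∀ p ∈ L, p.1 ≠ b) →
        (L.map fun p => (p.1, if p.1 = b then f p.2 else p.2)) = L := by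
      intro L hL
      conv_rhs => rw [← List.map_id L]
      exact List.map_congr_left fun p hp => by simp [hL p hp]
    unfold modify
    split_ifs with h1 h2
    · simp only [toList, ihl hl, List.map_append, List.map_cons]
      rw [key (toList r) (fun p hp => (h1.trans (har p hp)).ne')]
      simp [h1.ne']
    · simp only [toList, ihr hr, List.map_append, List.map_cons]
      rw [key (toList l) (fun p hp => ((hlr p hp).1.trans h2).ne)]
      simp [h2.ne]
    · obtain rfl : a = b := le_antisymm (not_lt.1 h1) (not_lt.1 h2)
      simp only [toList, List.map_append, List.map_cons]
      rw [key (toList l) (fun p hp => (hlr p hp).1.ne), key (toList r) (fun p hp => (har p hp).ne')]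
      simp

theorem perm_insertLeaf (b : κ) (k : ℕ) (t : STree κ) :
    (toList (insertLeaf b k t)).Perm ((b, k) :: toList t) := by
  induction t with
  | leaf => exact List.Perm.refl _
  | node l a m r ihl ihr =>
    unfold insertLeaf
    split_ifs
    · exact ihl.append_right _
    · exact ((ihr.cons _).append_left _).trans
        (((List.Perm.swap _ _ _).append_left _).trans List.perm_middle)

theorem sorted_insertLeaf (b : κ) (k : ℕ) (t : STree κ)
    (h : (toList t).Pairwise (fun p q => p.1 < q.1)) (hb : ∀ p ∈ toList t, p.1 ≠ b) :
    (toList (insertLeaf b k t)).Pairwise (fun p q => p.1 < q.1) := by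
  induction t with
  | leaf => simp [insertLeaf, toList]
  | node l a m r ihl ihr =>
    simp only [toList, List.pairwise_append, List.pairwise_cons, List.mem_cons, forall_eq_or_imp]
      at h
    obtain ⟨hl, ⟨har, hr⟩, hlr⟩ := h
    have hbl : ∀ p ∈ toList l, p.1 ≠ b := fun p hp => hb p (by simp [toList, hp])
    have hbr : ∀ p ∈ toList r, p.1 ≠ b := fun p hp => hb p (by simp [toList, hp])
    have hba : a ≠ b := hb (a, m) (by simp [toList])
    unfold insertLeaf
    split_ifs with h1
    · simp only [toList, List.pairwise_append, List.pairwise_cons, List.mem_cons, forall_eq_or_imp]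
      refine ⟨ihl hl hbl, ⟨har, hr⟩, fun p hp => ?_⟩
      rcases List.mem_cons.1 ((perm_insertLeaf b k l).mem_iff.1 hp) with rfl | hp
      · exact ⟨h1, fun q hq => h1.trans (har q hq)⟩
      · exact hlr p hp
    · have h2 : a < b := lt_of_le_of_ne (not_lt.1 h1) hba
      simp only [toList, List.pairwise_append, List.pairwise_cons, List.mem_cons, forall_eq_or_imp]
      refine ⟨hl, ⟨fun p hp => ?_, ihr hr hbr⟩, fun p hp => ⟨(hlr p hp).1, fun q hq => ?_⟩⟩
      · rcases List.mem_cons.1 ((perm_insertLeaf b k r).mem_iff.1 hp) with rfl | hp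
        · exact h2
        · exact har p hp
      · rcases List.mem_cons.1 ((perm_insertLeaf b k r).mem_iff.1 hq) with rfl | hq
        · exact (hlr p hp).1.trans h2
        · exact (hlr p hp).2 q hq

theorem ceil_eq_some (b : κ) (t : STree κ) (h : (toList t).Pairwise (fun p q => p.1 < q.1))
    (c : κ) : ceil b t = some c ↔ IsLeast {d | (∃ p ∈ toList t, p.1 = d) ∧ b ≤ d} c := by
  induction t generalizing c with
  | leaf => simp [ceil, toList, IsLeast]
  | node l a m r ihl ihr =>
    simp only [toList, List.pairwise_append, List.pairwise_cons, List.mem_cons, forall_eq_or_imp]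
      at h
    obtain ⟨hl, ⟨har, hr⟩, hlr⟩ := h
    have uniq : ∀ c', IsLeast {d | (∃ p ∈ toList (node l a m r), p.1 = d) ∧ b ≤ d} c' →
        (some c' = some c ↔ IsLeast {d | (∃ p ∈ toList (node l a m r), p.1 = d) ∧ b ≤ d} c) :=
      fun c' h' => ⟨fun e => Option.some.inj e ▸ h', fun h => congrArg some (h'.unique h)⟩
    unfold ceil
    split_ifs with h1 h2
    · apply uniq
      rcases hc : ceil b l with _ | c'
      · have hno : ∀ p ∈ toList l, p.1 < b := by
          intro p hp
          by_contra hlt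
          have hS : {d | (∃ p ∈ toList l, p.1 = d) ∧ b ≤ d}.Finite :=
            (List.finite_toSet ((toList l).map Prod.fst)).subset fun d hd => by
              obtain ⟨⟨q, hq, rfl⟩, -⟩ := hd
              exact List.mem_map_of_mem hq
          obtain ⟨e, he⟩ := hS.exists_minimal ⟨p.1, ⟨p, hp, rfl⟩, not_lt.1 hlt⟩
          have := (ihl hl e).2 ⟨he.1, fun d hd => (le_total e d).elim id fun h => he.2 hd h⟩
          simp [hc] at this
        refine ⟨⟨⟨(a, m), by simp [toList], rfl⟩, h1.le⟩, ?_⟩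
        rintro d ⟨⟨p, hp, rfl⟩, hd⟩
        simp only [toList, List.mem_append, List.mem_cons] at hp
        rcases hp with hp | rfl | hp
        · exact absurd (hno p hp) (not_lt.2 hd)
        · exact le_rfl
        · exact (har p hp).le
      · obtain ⟨⟨⟨q, hq, rfl⟩, hqb⟩, hmin⟩ := (ihl hl c').1 hc
        refine ⟨⟨⟨q, by simp [toList, hq], rfl⟩, hqb⟩, ?_⟩
        rintro d ⟨⟨p, hp, rfl⟩, hd⟩
        simp only [toList, List.mem_append, List.mem_cons] at hp
        rcases hp with hp | rfl | hp
        · exact hmin ⟨⟨p, hp, rfl⟩, hd⟩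
        · exact (hlr q hq).1.le
        · exact ((hlr q hq).2 p hp).le
    · rw [ihr hr c]
      have : {d | (∃ p ∈ toList (node l a m r), p.1 = d) ∧ b ≤ d} =
          {d | (∃ p ∈ toList r, p.1 = d) ∧ b ≤ d} := by
        ext d
        constructor
        · rintro ⟨⟨p, hp, rfl⟩, hd⟩
          simp only [toList, List.mem_append, List.mem_cons] at hp
          rcases hp with hp | rfl | hp
          · exact absurd ((hlr p hp).1.trans h2) (not_lt.2 hd)
          · exact absurd h2 (not_lt.2 hd)
          · exact ⟨⟨p, hp, rfl⟩, hd⟩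
        · rintro ⟨⟨p, hp, rfl⟩, hd⟩
          exact ⟨⟨p, by simp [toList, hp], rfl⟩, hd⟩
      rw [this]
    · obtain rfl : a = b := le_antisymm (not_lt.1 h1) (not_lt.1 h2)
      exact uniq a ⟨⟨⟨(a, m), by simp [toList], rfl⟩, le_rfl⟩, fun d hd => hd.2⟩

theorem weight_ne_zero {t : STree κ} (h : Good t) (b : κ) :
    weight t b ≠ 0 ↔ ∃ p ∈ toList t, p.1 = b := by
  simp only [weight, ne_eq, List.sum_eq_zero_iff, List.mem_map, forall_exists_index, and_imp,
    forall_apply_eq_imp_iff₂, not_forall]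
  constructor
  · rintro ⟨p, hp, hne⟩
    exact ⟨p, hp, by_contra fun hb => hne (if_neg hb)⟩
  · rintro ⟨p, hp, rfl⟩
    exact ⟨p, hp, by simpa using (h.2 p hp).ne'⟩

theorem weight_eq {t : STree κ} (h : (toList t).Pairwise (fun p q => p.1 < q.1)) {p : κ × ℕ}
    (hp : p ∈ toList t) : weight t p.1 = p.2 := by
  unfold weight
  generalize toList t = L at h hp
  induction L with
  | nil => simp at hp
  | cons q l ih =>
    rw [List.pairwise_cons] at h
    rcases List.mem_cons.1 hp with rfl | hp
    · have : (l.map fun q => if q.1 = p.1 then q.2 else 0).sum = 0 := by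
        rw [List.sum_eq_zero_iff]
        intro x hx
        obtain ⟨q, hq, rfl⟩ := List.mem_map.1 hx
        exact if_neg (h.1 q hq).ne'
      simp [this]
    · simp [ih h.2 hp, (h.1 p hp).ne]

theorem weight_delete (b : κ) {t : STree κ} (h : Good t) :
    weight (delete b t) = Function.update (weight t) b 0 := by
  funext c
  unfold weight
  rw [toList_delete b t h.1]
  induction toList t with
  | nil => by_cases hc : c = b <;> simp [Function.update, hc]
  | cons q l ih =>
    by_cases hc : c = b <;> by_cases hq : q.1 = b <;>
      simp_all [Function.update]
    intro e; exact absurd e.symm hc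

theorem good_delete (b : κ) {t : STree κ} (h : Good t) : Good (delete b t) := by
  unfold Good
  rw [toList_delete b t h.1]
  exact ⟨h.1.filter _, fun p hp => h.2 p (List.mem_of_mem_filter hp)⟩

theorem weight_insertLeaf (b : κ) (k : ℕ) {t : STree κ} (hb : weight t b = 0) :
    weight (insertLeaf b k t) = Function.update (weight t) b k := by
  funext c
  have : weight (insertLeaf b k t) c = (if b = c then k else 0) + weight t c := by
    unfold weight
    rw [((perm_insertLeaf b k t).map _).sum_eq]
    simp
  rw [this]
  by_cases hc : c = b
  · subst hc; simp [hb]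
  · simp [Function.update, hc, Ne.symm hc]

theorem good_insertLeaf (b : κ) {k : ℕ} (hk : 0 < k) {t : STree κ} (h : Good t)
    (hb : weight t b = 0) : Good (insertLeaf b k t) := by
  refine ⟨sorted_insertLeaf b k t h.1 fun p hp e => (weight_ne_zero h b).2 ⟨p, hp, e⟩ hb, ?_⟩
  intro p hp
  rcases List.mem_cons.1 ((perm_insertLeaf b k t).mem_iff.1 hp) with rfl | hp
  · exact hk
  · exact h.2 p hp

theorem sorted_modify (b : κ) (f : ℕ → ℕ) {t : STree κ}
    (h : (toList t).Pairwise (fun p q => p.1 < q.1)) :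
    (toList (modify b f t)).Pairwise (fun p q => p.1 < q.1) := by
  rw [toList_modify b f t h]
  exact List.pairwise_map.2 h

theorem weight_modify (b : κ) (f : ℕ → ℕ) {t : STree κ} (h : Good t) (hb : weight t b ≠ 0) :
    weight (modify b f t) = Function.update (weight t) b (f (weight t b)) := by
  funext c
  by_cases hc : c = b
  · subst hc
    obtain ⟨p, hp, rfl⟩ := (weight_ne_zero h c).1 hb
    have hmem : (p.1, f p.2) ∈ toList (modify p.1 f t) := by
      rw [toList_modify p.1 f t h.1]
      exact List.mem_map.2 ⟨p, hp, by simp⟩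
    rw [Function.update_self, weight_eq h.1 hp]
    exact weight_eq (sorted_modify _ f h.1) hmem
  · rw [Function.update_of_ne hc]
    unfold weight
    rw [toList_modify b f t h.1, List.map_map]
    congr 1
    refine List.map_congr_left fun p _ => ?_
    by_cases hp : p.1 = c
    · simp [hp, hc]
    · simp [hp]

theorem good_modify (b : κ) {f : ℕ → ℕ} {t : STree κ} (h : Good t)
    (hf : 0 < f (weight t b)) : Good (modify b f t) := by
  refine ⟨sorted_modify b f h.1, fun p hp => ?_⟩
  rw [toList_modify b f t h.1] at hp
  obtain ⟨q, hq, rfl⟩ := List.mem_map.1 hp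
  by_cases hqb : q.1 = b
  · subst hqb
    rw [weight_eq h.1 hq] at hf
    simpa using hf
  · simpa [hqb] using h.2 q hq

end STree

/-- Splay trees as a gap data structure: one node for each gap, whose key is the right boundary and
whose weight is the size of the gap. Every operation splays the node it works on; the running time
is the number of nodes visited. (`increment`, `decrement` and `add` do not change the tree when
applied outside their domain.) -/
def splayGapDS (α : Type u) [LinearOrder α] : GapDS.{u, u} α where
  State := { t : STree (WithTop α) // t.Good }
  size s := s.1.weight
  empty := ⟨.leaf, by simp [STree.Good, STree.toList]⟩
  locate x s :=
    let t := s.1.splay (x : WithTop α)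
    match s.1.ceil (x : WithTop α) with
    | none => ⟨(⟨t, STree.good_splay _ s.2⟩, none), 2 * s.1.cost (x : WithTop α)⟩
    | some c => ⟨(⟨t.splay c, STree.good_splay _ (STree.good_splay _ s.2)⟩, some c),
        2 * s.1.cost (x : WithTop α) + t.cost c⟩
  increment b s :=
    let t := s.1.splay b
    ⟨⟨t.modify b (· + 1), STree.good_modify b (STree.good_splay _ s.2) (Nat.succ_pos _)⟩,
      s.1.cost b + t.cost b⟩
  decrement b s :=
    let t := s.1.splay b
    ⟨if h : 1 < t.weight b then
        ⟨t.modify b (· - 1), STree.good_modify b (STree.good_splay _ s.2) (Nat.sub_pos_of_lt h)⟩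
      else ⟨t, STree.good_splay _ s.2⟩, s.1.cost b + t.cost b⟩
  remove b s :=
    let t := s.1.splay b
    ⟨⟨t.delete b, STree.good_delete b (STree.good_splay _ s.2)⟩, s.1.cost b + t.deleteCost b⟩
  add b k s :=
    ⟨if h : s.1.weight b = 0 ∧ 0 < k then
        ⟨(s.1.insertLeaf b k).splay b, STree.good_splay _ (STree.good_insertLeaf b h.2 s.2 h.1)⟩
      else s, s.1.cost b + (s.1.insertLeaf b k).cost b⟩
  size_empty b := rfl
  size_locate x s := by
    dsimp only
    split <;> simp [STree.weight_splay]
  locate_eq_some x s b := by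
    have hS : {c : WithTop α | s.1.weight c ≠ 0 ∧ (x : WithTop α) ≤ c} =
        {d | (∃ p ∈ s.1.toList, p.1 = d) ∧ (x : WithTop α) ≤ d} := by
      ext d
      exact and_congr_left' (STree.weight_ne_zero s.2 d)
    rw [hS, ← STree.ceil_eq_some _ _ s.2.1]
    dsimp only
    split <;> rename_i h <;> simp [h]
  size_increment b s h := by
    dsimp only
    rw [STree.weight_modify b _ (STree.good_splay _ s.2) (by rwa [STree.weight_splay]),
      STree.weight_splay]
  size_decrement b s h := by
    have h' : 1 < (s.1.splay b).weight b := by rwa [STree.weight_splay]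
    dsimp only
    rw [dif_pos h']
    dsimp only
    rw [STree.weight_modify b _ (STree.good_splay _ s.2) (by omega), STree.weight_splay]
  size_remove b s _ := by
    dsimp only
    rw [STree.weight_delete b (STree.good_splay _ s.2), STree.weight_splay]
  size_add b k s h hk := by
    dsimp only
    rw [dif_pos ⟨h, hk⟩]
    dsimp only
    rw [STree.weight_splay, STree.weight_insertLeaf b k h]

/-! Intervals. -/

/-- An interval: an unordered bag of elements, with the splitting key that separates it from its
successor. Its elements are at most `router` and larger than the router of the preceding
interval. -/
structure GapInterval (α : Type u) where
  router : WithTop α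
  elems : List α

namespace GapInterval

variable {α : Type u} [LinearOrder α]

def size (I : GapInterval α) : ℕ := I.elems.length

/-- Concatenation of an interval with its right neighbour. -/
def merge (I J : GapInterval α) : GapInterval α := ⟨J.router, I.elems ++ J.elems⟩

/-- The total number of elements in a list of intervals. -/
def total (l : List (GapInterval α)) : ℕ := (l.map size).sum

/-- Split a bag into the elements that are at most `x` and the elements larger than `x`. -/
def partition (x : α) (l : List α) : Timed (List α × List α) :=
  Timed.tick l.length (Timed.ret (l.filter (· ≤ x), l.filter (x < ·)))

/-- The element of index `k` (starting from 0) of the sorted version of a short list. -/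
def selectShort (d : α) (k : ℕ) (l : List α) : Timed α :=
  Timed.tick (l.length ^ 2) (Timed.ret ((l.insertionSort (· ≤ ·)).getD k d))

/-- The medians of the given (short) lists. -/
def medians (d : α) : List (List α) → Timed (List α)
  | [] => Timed.ret []
  | c :: cs => selectShort d (c.length / 2) c ⇝ fun m => medians d cs ⇝ fun ms =>
      Timed.ret (m :: ms)

/-- Linear-time selection by the median of medians: the element of index `k` (starting from 0) in
sorted order. The first argument bounds the depth of the recursion; the length of the list
suffices. -/
def select (d : α) : ℕ → ℕ → List α → Timed α
  | 0, _, _ => Timed.ret d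
  | f + 1, k, l =>
    if l.length ≤ 5 then selectShort d k l
    else
      Timed.tick l.length (medians d (l.toChunks 5) ⇝ fun ms =>
        select d f (ms.length / 2) ms ⇝ fun p =>
        let lo := l.filter (· < p)
        let eq := l.filter (· = p)
        let hi := l.filter (p < ·)
        Timed.tick (3 * l.length)
          (if k < lo.length then select d f k lo
          else if k < lo.length + eq.length then Timed.ret p
          else select d f (k - lo.length - eq.length) hi))

/-- Split an interval into its `k` smallest elements and the others (elements equal to the `k`-th
smallest stay together in the left part). No empty interval is created. -/
def splitAt (k : ℕ) (I : GapInterval α) : Timed (List (GapInterval α)) :=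
  match I.elems with
  | [] => Timed.ret []
  | d :: _ =>
    if k = 0 ∨ I.size ≤ k then Timed.ret [I]
    else
      select d I.size (k - 1) I.elems ⇝ fun m =>
      partition m I.elems ⇝ fun p =>
      Timed.ret (if p.1.isEmpty || p.2.isEmpty then [I] else [⟨m, p.1⟩, ⟨I.router, p.2⟩])

/-- Replacement of the part left of the query: it is split into two halves (the left one getting
the extra element), and the right half is split once more in the same way. -/
def refineLeft (I : GapInterval α) : Timed (List (GapInterval α)) :=
  splitAt ((I.size + 1) / 2) I ⇝ fun l =>
  match l with
  | [A, B] => splitAt ((B.size + 1) / 2) B ⇝ fun l' => Timed.ret (A :: l')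
  | _ => Timed.ret l

/-- Replacement of the part right of the query: the mirror image of `refineLeft`. -/
def refineRight (I : GapInterval α) : Timed (List (GapInterval α)) :=
  splitAt (I.size / 2) I ⇝ fun l =>
  match l with
  | [A, B] => splitAt (A.size / 2) A ⇝ fun l' => Timed.ret (l' ++ [B])
  | _ => Timed.ret l

/-- Merging of intervals on one side of a gap, from the boundary inwards: the current interval `I`,
which has `before` elements between itself and the boundary, is merged (by `f`) with the next
interval `J` if `before` is at least `|I| + |J|`. -/
def mergePass (f : GapInterval α → GapInterval α → GapInterval α) :
    ℕ → GapInterval α → List (GapInterval α) → Timed (List (GapInterval α))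
  | _, I, [] => Timed.ret [I]
  | before, I, J :: rest =>
    Timed.tick 1
      (if I.size + J.size ≤ before then mergePass f before (f I J) rest
      else mergePass f (before + I.size) J rest ⇝ fun l => Timed.ret (I :: l))

def mergeSide (f : GapInterval α → GapInterval α → GapInterval α) :
    List (GapInterval α) → Timed (List (GapInterval α))
  | [] => Timed.ret []
  | I :: rest => mergePass f 0 I rest

/-- The number of intervals on the left side of a gap with `tot` elements both of whose boundaries
were created by queries: the intervals that have at most as many elements of the gap to their left
as to their right. `before` is the number of elements already passed. -/
def leftCount (tot : ℕ) : ℕ → List (GapInterval α) → ℕ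
  | _, [] => 0
  | before, I :: rest =>
    if before ≤ tot - (before + I.size) then leftCount tot (before + I.size) rest + 1 else 0

/-- The merging rule applied to a gap. The flags tell whether its left and right boundaries were
created by queries; every interval belongs to the side of the closest such boundary. -/
def rebalance (leftQuery rightQuery : Bool) (l : List (GapInterval α)) :
    Timed (List (GapInterval α)) :=
  Timed.tick l.length
    (if leftQuery || rightQuery then
      let k := if leftQuery && rightQuery then leftCount (total l) 0 l
        else if leftQuery then l.length else 0
      mergeSide merge (l.take k) ⇝ fun A =>
      mergeSide (fun I J => merge J I) (l.drop k).reverse ⇝ fun B =>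
      Timed.ret (A ++ B.reverse)
    else Timed.ret l)

/-- Binary search: the first index `i` with `lo ≤ i < lo + len` and `x ≤ r i`, or `lo + len` if
there is none, for a nondecreasing `r`. -/
def bsearch (r : ℕ → WithTop α) (x : α) (lo len : ℕ) : Timed ℕ :=
  if h : len = 0 then Timed.ret lo
  else
    Timed.tick 1
      (if (x : WithTop α) ≤ r (lo + len / 2) then bsearch r x lo (len / 2)
      else bsearch r x (lo + len / 2 + 1) (len - len / 2 - 1))
termination_by len
decreasing_by all_goals omega

/-- The index of the interval of a gap into which `x` falls (the last one if `x` exceeds all other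
routers). The intervals of a gap are kept in sorted order in an array. -/
def find (x : α) (l : List (GapInterval α)) : Timed ℕ :=
  bsearch (fun i => (l.map router).getD i ⊤) x 0 (l.length - 1)

end GapInterval

/-! Lazy search trees. -/

/-- The second level of a lazy search tree: the intervals of one gap. `last` is the element whose
access created the right boundary of the gap (its largest element), if there is one; `leftQuery`
tells whether the left boundary was created by a query. -/
structure Gap (α : Type u) where
  intervals : List (GapInterval α)
  last : Option α
  leftQuery : Bool

/-- A lazy search tree over the gap data structure `D`. `gap b` is the interval structure that the
node of the gap with right boundary `b` points to; it is irrelevant if there is no such gap.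
`count` is the number of elements. -/
structure LST {α : Type u} [LinearOrder α] (D : GapDS.{u, v} α) where
  gaps : D.State
  gap : WithTop α → Gap α
  count : ℕ

namespace LST

variable {α : Type u} [LinearOrder α] {D : GapDS.{u, v} α}

/-- Construction: a single gap with a single interval (no gap if there are no elements). -/
def construct (D : GapDS.{u, v} α) (S : List α) : Timed (LST D) :=
  Timed.tick (S.length + 1)
    ((if S.isEmpty then Timed.ret D.empty else D.add ⊤ S.length D.empty) ⇝ fun s =>
      Timed.ret ⟨s, fun _ => ⟨[⟨⊤, S⟩], none, false⟩, S.length⟩)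

/-- Insertion: find the gap, find the interval by binary search, put the element into it. An
element larger than all boundaries opens a new last gap. -/
def insert (x : α) (T : LST D) : Timed (LST D) :=
  D.locate x T.gaps ⇝ fun p =>
  match p.2 with
  | none =>
    D.add ⊤ 1 p.1 ⇝ fun s =>
    Timed.tick 1 (Timed.ret ⟨s,
      Function.update T.gap ⊤ ⟨[⟨⊤, [x]⟩], none, decide (0 < T.count)⟩, T.count + 1⟩)
  | some b =>
    let g := T.gap b
    GapInterval.find x g.intervals ⇝ fun j =>
    D.increment b p.1 ⇝ fun s =>
    Timed.tick 1 (Timed.ret ⟨s,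
      Function.update T.gap b
        { g with intervals := g.intervals.modify j fun I => { I with elems := x :: I.elems } },
      T.count + 1⟩)

/-- The query procedure for an element `x` in the gap with right boundary `b`; `s` is the current
state of the gap data structure. The interval of `x` is partitioned around `x`, both parts are
refined, the gap is replaced by two gaps (the left one ending with `x`; the right one only if
it is nonempty), and the merging rule is applied to them. -/
def query (x : α) (b : WithTop α) (s : D.State) (T : LST D) : Timed (LST D × Option α) :=
  let g := T.gap b
  GapInterval.find x g.intervals ⇝ fun j =>
  let I := g.intervals.getD j ⟨b, []⟩
  GapInterval.partition x I.elems ⇝ fun p =>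
  Timed.tick p.1.length
    (if x ∈ p.1 then
      GapInterval.refineLeft ⟨(x : WithTop α), p.1⟩ ⇝ fun ls =>
      GapInterval.refineRight ⟨I.router, p.2⟩ ⇝ fun rs =>
      GapInterval.rebalance g.leftQuery true (g.intervals.take j ++ ls) ⇝ fun A =>
      GapInterval.rebalance true (decide (b ≠ ⊤)) (rs ++ g.intervals.drop (j + 1)) ⇝ fun B =>
      Timed.tick (A.length + B.length)
        (D.remove b s ⇝ fun s₁ =>
        D.add (x : WithTop α) (GapInterval.total A) s₁ ⇝ fun s₂ =>
        (if B.isEmpty then Timed.ret s₂ else D.add b (GapInterval.total B) s₂) ⇝ fun s₃ =>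
        Timed.ret (⟨s₃,
          Function.update (Function.update T.gap b ⟨B, g.last, true⟩) (x : WithTop α)
            ⟨A, some x, g.leftQuery⟩, T.count⟩, some x))
    else Timed.ret (⟨s, T.gap, T.count⟩, none))

/-- Access to an element: find its gap and follow the pointer to the interval structure (one step).
If the element created the right boundary of this gap by an earlier access (one comparison), it is
returned and nothing is restructured; otherwise the query procedure is run. -/
def access (x : α) (T : LST D) : Timed (LST D × Option α) :=
  D.locate x T.gaps ⇝ fun p =>
  match p.2 with
  | none => Timed.ret (⟨p.1, T.gap, T.count⟩, none)
  | some b =>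
    Timed.tick 2
      (if (T.gap b).last = some x then Timed.ret (⟨p.1, T.gap, T.count⟩, some x)
      else query x b p.1 T)

end LST

/-! The gap data structure on its own. -/

/-- The gap data structure serving a sequence of operations by itself: its state, the elements
present, and the elements accessed so far. The boundaries between gaps are the accessed
elements. -/
structure GapRun {α : Type u} [LinearOrder α] (D : GapDS.{u, v} α) where
  state : D.State
  elems : List α
  accessed : Finset α

namespace GapRun

variable {α : Type u} [LinearOrder α] {D : GapDS.{u, v} α}

/-- The right boundary of the gap into which `y` falls when the elements of `A` have been accessed:
the least element of `A` that is at least `y`, or `⊤`. -/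
def boundary (A : Finset α) (y : α) : WithTop α := (A.filter (y ≤ ·)).min

/-- The number of elements of `E` in the gap with right boundary `b`. -/
def gapSize (E : List α) (A : Finset α) (b : WithTop α) : ℕ :=
  E.countP fun y => boundary A y = b

def construct (D : GapDS.{u, v} α) (S : List α) : Timed (GapRun D) :=
  (if S.isEmpty then Timed.ret D.empty else D.add ⊤ S.length D.empty) ⇝ fun s =>
    Timed.ret ⟨s, S, ∅⟩

def insert (x : α) (G : GapRun D) : Timed (GapRun D) :=
  D.locate x G.state ⇝ fun p =>
  let b := boundary G.accessed x
  (if gapSize G.elems G.accessed b = 0 then D.add b 1 p.1 else D.increment b p.1) ⇝ fun s =>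
  Timed.ret ⟨s, x :: G.elems, G.accessed⟩

/-- Access to `x`: its gap is located. At the first access to `x` this gap is then replaced by the
two gaps that result from making `x` a boundary (the right one only if it is nonempty). -/
def access (x : α) (G : GapRun D) : Timed (GapRun D) :=
  D.locate x G.state ⇝ fun p =>
  if x ∈ G.accessed then Timed.ret ⟨p.1, G.elems, G.accessed⟩
  else
    let b := boundary G.accessed x
    let A := Insert.insert x G.accessed
    D.remove b p.1 ⇝ fun s₁ =>
    D.add (x : WithTop α) (gapSize G.elems A x) s₁ ⇝ fun s₂ =>
    (if gapSize G.elems A b = 0 then Timed.ret s₂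
      else D.add b (gapSize G.elems A b) s₂) ⇝ fun s₃ =>
    Timed.ret ⟨s₃, G.elems, A⟩

end GapRun

/-! Sequences of operations. -/

inductive Op (α : Type u) where
  | insert (x : α)
  | access (x : α)

namespace Op

variable {α : Type u} [LinearOrder α]

/-- Starting with the elements `S`, every accessed element is present at the time of its access. -/
def Legal : List α → List (Op α) → Prop
  | _, [] => True
  | S, insert x :: ops => Legal (x :: S) ops
  | S, access x :: ops => x ∈ S ∧ Legal S ops

/-- The elements accessed by a sequence of operations. -/
def accessed : List (Op α) → Finset α
  | [] => ∅
  | insert _ :: ops => accessed ops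
  | access x :: ops => Insert.insert x (accessed ops)

end Op

section Runs

variable {α : Type u} [LinearOrder α] {D : GapDS.{u, v} α}

def LST.apply (T : LST D) : Op α → Timed (LST D)
  | .insert x => T.insert x
  | .access x => T.access x ⇝ fun p => Timed.ret p.1

def GapRun.apply (G : GapRun D) : Op α → Timed (GapRun D)
  | .insert x => G.insert x
  | .access x => G.access x

/-- The lazy search tree over `D` constructed on `S`, after the operations `ops`. -/
def LST.after (D : GapDS.{u, v} α) (S : List α) (ops : List (Op α)) : LST D :=
  ops.foldl (fun T o => (T.apply o).val) (LST.construct D S).val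

/-- The gap data structure `D` on its own, constructed on `S`, after the operations `ops`. -/
def GapRun.after (D : GapDS.{u, v} α) (S : List α) (ops : List (Op α)) : GapRun D :=
  ops.foldl (fun G o => (G.apply o).val) (GapRun.construct D S).val

/-- The time a data structure (with operations `step`) spends on the access sequence `xs`,
disregarding the first access to each element: only accesses to elements that lie in `A` (the
elements accessed before) or occur earlier in `xs` are counted. -/
def repeatTime {σ : Type w} (step : σ → Op α → Timed σ) : σ → Finset α → List α → ℕ
  | _, _, [] => 0
  | T, A, x :: xs =>
    (if x ∈ A then (step T (.access x)).time else 0) +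
      repeatTime step (step T (.access x)).val (Insert.insert x A) xs

end Runs

/-! The lazy search tree and the gap data structure on its own send `D` the same calls with the same
arguments in the same order, so `D` is in the same state on both sides after every operation. A
repeated access to `x` only locates the gap of `x` on either side; the tree then follows one pointer
and makes one comparison, which succeeds because `x` is the right boundary of its gap. The excess is
therefore exactly two steps per repeated access. No potential function is needed, and neither first
accesses nor the interval structures are ever charged.

What has to be proved is that the calls coincide. This is the invariant `LST.Agree`: the states of
`D` are equal, accessed elements stay present, the sizes stored in `D` count the elements of each
gap, and the intervals of every nonempty gap hold exactly its elements, in sorted order. The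
critical case is a first access: a present `x` must be found by the binary search (`find_spec`,
`Sorted.mem_of_mem_content`), and the two new gaps must have the sizes that follow from the accessed
set alone (`Sorted.divide_left`, `Sorted.divide_right`, `boundary_insert_eq_self_iff`,
`boundary_insert_eq_boundary_iff`). Splitting and merging merely regroup elements (`Refines`,
`rebalance_induction`), so the choice of pivots and the merging threshold play no role.
`LST.Agree.access_of_mem` and `LST.Agree.repeatTime_le` turn the invariant into the bound. -/

set_option linter.unusedSectionVars false

/-! ### Sorted sequences of intervals. -/

namespace GapInterval

variable {α : Type u} [LinearOrder α]

/-- `I` lies to the left of `J`, separated from it by the router of `I`. -/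
def Before (I J : GapInterval α) : Prop :=
  (∀ y ∈ I.elems, (y : WithTop α) ≤ I.router) ∧ ∀ y ∈ J.elems, I.router < (y : WithTop α)

/-- A sorted sequence of nonempty intervals. -/
def Sorted (l : List (GapInterval α)) : Prop :=
  l.Pairwise Before ∧ ∀ I ∈ l, I.elems ≠ []

/-- All elements of a list of intervals. -/
def content (l : List (GapInterval α)) : List α := l.flatMap elems

theorem content_append (l l' : List (GapInterval α)) :
    content (l ++ l') = content l ++ content l' := by simp [content]

theorem content_cons (I : GapInterval α) (l : List (GapInterval α)) :
    content (I :: l) = I.elems ++ content l := by simp [content]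

theorem total_eq_length_content (l : List (GapInterval α)) : total l = (content l).length := by
  simp only [total, content, List.length_flatMap]
  rfl

/-- An element of `J` is what makes the router of `I` smaller than that of `J`, so that the elements
of `I` respect the router kept by the merge. This is why `Sorted` demands nonempty intervals. -/
theorem Before.merge_left {I J K : GapInterval α} (hJ : J.elems ≠ []) (h : Before I J)
    (h' : Before J K) : Before (merge I J) K := by
  obtain ⟨z, hz⟩ := List.exists_mem_of_ne_nil _ hJ
  refine ⟨fun y hy => ?_, h'.2⟩
  rcases List.mem_append.1 hy with hy | hy
  · exact (h.1 y hy).trans ((h.2 z hz).le.trans (h'.1 z hz))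
  · exact h'.1 y hy

theorem Before.merge_right {I J K : GapInterval α} (h : Before K I) (h' : Before K J) :
    Before K (merge I J) :=
  ⟨h.1, fun y hy => (List.mem_append.1 hy).elim (h.2 y) (h'.2 y)⟩

theorem Sorted.merge {P Q : List (GapInterval α)} {I J : GapInterval α}
    (h : Sorted (P ++ I :: J :: Q)) : Sorted (P ++ merge I J :: Q) := by
  obtain ⟨h1, h2⟩ := h
  have hJ : J.elems ≠ [] := h2 J (by simp)
  simp only [List.pairwise_append, List.pairwise_cons, List.mem_cons, forall_eq_or_imp] at h1
  obtain ⟨hP, ⟨⟨hIJ, hIQ⟩, hJQ, hQ⟩, hPQ⟩ := h1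
  refine ⟨?_, fun K hK => ?_⟩
  · simp only [List.pairwise_append, List.pairwise_cons, List.mem_cons, forall_eq_or_imp]
    exact ⟨hP, ⟨fun K hK => hIJ.merge_left hJ (hJQ K hK), hQ⟩,
      fun K hK => ⟨(hPQ K hK).1.merge_right (hPQ K hK).2.1, (hPQ K hK).2.2⟩⟩
  · simp only [List.mem_append, List.mem_cons] at hK
    rcases hK with hK | rfl | hK
    · exact h2 K (by simp [hK])
    · simp [GapInterval.merge, hJ]
    · exact h2 K (by simp [hK])

/-! ### The merging rule preserves order and content. -/

/-- The pass is a succession of merges of neighbours inside a larger sequence, so anything stable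
under one such merge survives, whatever the threshold decides. Intervals already passed move into
the context `P`. -/
theorem mergePass_left_induction {p : List (GapInterval α) → Prop}
    (hp : ∀ P I J Q, p (P ++ I :: J :: Q) → p (P ++ merge I J :: Q))
    (n : ℕ) (I : GapInterval α) (rest P Q : List (GapInterval α))
    (h : p (P ++ (I :: rest ++ Q))) : p (P ++ ((mergePass merge n I rest).val ++ Q)) := by
  induction rest generalizing n I P with
  | nil => exact h
  | cons J rest ih =>
    simp only [mergePass, Timed.tick]
    split_ifs
    · exact ih _ _ _ (hp _ _ _ _ h)
    · simpa [Timed.bind, Timed.ret] using ih (n + I.size) J (P ++ [I]) (by simpa using h)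

/-- The pass walks a reversed list, so finished intervals move into `Q`, and the swapped arguments
of `merge` keep the true left-to-right order. -/
theorem mergePass_right_induction {p : List (GapInterval α) → Prop}
    (hp : ∀ P I J Q, p (P ++ I :: J :: Q) → p (P ++ merge I J :: Q))
    (n : ℕ) (I : GapInterval α) (rest P Q : List (GapInterval α))
    (h : p (P ++ ((I :: rest).reverse ++ Q))) :
    p (P ++ ((mergePass (fun I J => merge J I) n I rest).val.reverse ++ Q)) := by
  induction rest generalizing n I Q with
  | nil => exact h
  | cons J rest ih =>
    simp only [mergePass, Timed.tick]
    split_ifs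
    · refine ih _ _ _ ?_
      simpa using hp (P ++ rest.reverse) J I Q (by simpa using h)
    · simpa [Timed.bind, Timed.ret] using ih (n + I.size) J (I :: Q) (by simpa using h)

theorem rebalance_induction {p : List (GapInterval α) → Prop}
    (hp : ∀ P I J Q, p (P ++ I :: J :: Q) → p (P ++ merge I J :: Q))
    (a b : Bool) (l : List (GapInterval α)) (h : p l) :
    p (rebalance a b l).val := by
  have left : ∀ l Q, p (l ++ Q) → p ((mergeSide merge l).val ++ Q) := by
    rintro (_ | ⟨I, l⟩) Q h
    · exact h
    · exact mergePass_left_induction hp 0 I l [] Q h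
  have right : ∀ P l, p (P ++ l.reverse) →
      p (P ++ (mergeSide (fun I J => merge J I) l).val.reverse) := by
    rintro P (_ | ⟨I, l⟩) h
    · exact h
    · simpa [mergeSide] using mergePass_right_induction hp 0 I l P [] (by simpa using h)
  simp only [rebalance, Timed.tick]
  split_ifs <;> first | exact h | skip
  all_goals
    simp only [Timed.bind, Timed.ret]
    exact right _ _ (left _ _ (by simpa [List.take_append_drop] using h))

theorem sorted_rebalance (a b : Bool) {l : List (GapInterval α)} (h : Sorted l) :
    Sorted (rebalance a b l).val :=
  rebalance_induction (fun _ _ _ _ h => h.merge) a b l h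

theorem content_rebalance (a b : Bool) (l : List (GapInterval α)) :
    content (rebalance a b l).val = content l :=
  rebalance_induction (p := fun l' => content l' = content l)
    (fun P I J Q h => by simpa [content, GapInterval.merge] using h) a b l rfl

/-! ### Splitting an interval. -/

/-- `L` is a sorted sequence of intervals into which `I` has been divided. -/
structure Refines (L : List (GapInterval α)) (I : GapInterval α) : Prop where
  sorted : Sorted L
  perm : (content L).Perm I.elems
  before : ∀ J, Before I J → ∀ I' ∈ L, Before I' J

theorem Refines.after {L : List (GapInterval α)} {I J I' : GapInterval α} (h : Refines L I)
    (hJ : Before J I) (hI' : I' ∈ L) : Before J I' :=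
  ⟨hJ.1, fun y hy => hJ.2 y (h.perm.mem_iff.1 (List.mem_flatMap.2 ⟨I', hI', hy⟩))⟩

theorem refines_singleton {I : GapInterval α} (h : I.elems ≠ []) : Refines [I] I :=
  ⟨by simp [Sorted, h], by simp [content], by simp⟩

theorem Refines.replace {L P Q : List (GapInterval α)} {I : GapInterval α} (h : Refines L I)
    (hl : (P ++ I :: Q).Pairwise Before) (hne : ∀ J ∈ P ++ Q, J.elems ≠ []) :
    Sorted (P ++ (L ++ Q)) := by
  simp only [List.pairwise_append, List.pairwise_cons, List.mem_cons, forall_eq_or_imp] at hl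
  obtain ⟨hP, ⟨hIQ, hQ⟩, hPQ⟩ := hl
  refine ⟨?_, fun K hK => ?_⟩
  · simp only [List.pairwise_append, List.mem_append]
    refine ⟨hP, ⟨h.sorted.1, hQ, fun I' hI' J hJ => h.before J (hIQ J hJ) I' hI'⟩,
      fun K hK J hJ => hJ.elim (h.after (hPQ K hK).1) ((hPQ K hK).2 J)⟩
  · simp only [List.mem_append] at hK
    rcases hK with hK | hK | hK
    · exact hne K (by simp [hK])
    · exact h.sorted.2 K hK
    · exact hne K (by simp [hK])

theorem filter_le_append_filter_lt_perm (x : α) (l : List α) :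
    (l.filter (· ≤ x) ++ l.filter (x < ·)).Perm l := by
  have h := List.filter_append_perm (fun y => decide (y ≤ x)) l
  simpa [← not_le] using h

theorem refines_splitAt (k : ℕ) (I : GapInterval α) : Refines (splitAt k I).val I := by
  obtain ⟨r, _ | ⟨d, E⟩⟩ := I
  · exact ⟨by simp [splitAt, Timed.ret, Sorted], by simp [splitAt, Timed.ret, content],
      by simp [splitAt, Timed.ret]⟩
  · have hne : (⟨r, d :: E⟩ : GapInterval α).elems ≠ [] := List.cons_ne_nil _ _
    simp only [splitAt]
    split_ifs with hk
    · exact refines_singleton hne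
    -- The selected pivot is forgotten: any `m` gives a valid division, so the correctness of median
    -- selection is not needed.
    generalize (select d _ _ _) = m
    simp only [Timed.bind, Timed.ret, partition, Timed.tick]
    have hp := filter_le_append_filter_lt_perm m.val (d :: E)
    have hle : ∀ y ∈ (d :: E).filter (· ≤ m.val), y ≤ m.val := fun y hy => by
      simpa using (List.mem_filter.1 hy).2
    have hlt : ∀ y ∈ (d :: E).filter (m.val < ·), m.val < y := fun y hy => by
      simpa using (List.mem_filter.1 hy).2
    have hmem : ∀ y ∈ (d :: E).filter (m.val < ·), y ∈ d :: E := fun y hy =>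
      (List.mem_filter.1 hy).1
    change Refines (if ((d :: E).filter (· ≤ m.val)).isEmpty ||
      ((d :: E).filter (m.val < ·)).isEmpty then [⟨r, d :: E⟩] else
      [⟨m.val, (d :: E).filter (· ≤ m.val)⟩, ⟨r, (d :: E).filter (m.val < ·)⟩]) _
    split_ifs with h
    · exact refines_singleton hne
    · simp only [Bool.or_eq_true, List.isEmpty_iff, not_or] at h
      obtain ⟨z, hz⟩ := List.exists_mem_of_ne_nil _ h.2
      refine ⟨⟨?_, ?_⟩, ?_, fun J hJ => ?_⟩
      · simp only [List.pairwise_cons, List.mem_cons, List.not_mem_nil, or_false, forall_eq]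
        exact ⟨⟨fun y hy => WithTop.coe_le_coe.2 (hle y hy),
          fun y hy => WithTop.coe_lt_coe.2 (hlt y hy)⟩, by simp⟩
      · simp only [List.mem_cons, List.not_mem_nil, or_false, forall_eq_or_imp, forall_eq]
        exact h
      · simpa only [content, List.flatMap_cons, List.flatMap_nil, List.append_nil] using hp
      · have hr : ((m.val : α) : WithTop α) < r :=
          (WithTop.coe_lt_coe.2 (hlt z hz)).trans_le (hJ.1 z (hmem z hz))
        simp only [List.mem_cons, List.not_mem_nil, or_false, forall_eq_or_imp, forall_eq]
        exact ⟨⟨fun y hy => WithTop.coe_le_coe.2 (hle y hy), fun y hy => hr.trans (hJ.2 y hy)⟩,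
          fun y hy => hJ.1 y (hmem y hy), hJ.2⟩

/-- Transitivity of refinement, for the second split, which divides only one of the two halves. -/
theorem Refines.replace_refines {L P Q : List (GapInterval α)} {I J : GapInterval α}
    (hI : Refines (P ++ J :: Q) I) (hJ : Refines L J) : Refines (P ++ (L ++ Q)) I := by
  refine ⟨hJ.replace hI.sorted.1 fun K hK => hI.sorted.2 K (by aesop), ?_, fun K hK I' hI' => ?_⟩
  · refine List.Perm.trans ?_ hI.perm
    simp only [content_append, content_cons]
    exact (hJ.perm.append_right _).append_left _
  · simp only [List.mem_append] at hI'
    rcases hI' with h | h | h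
    · exact hI.before K hK _ (by simp [h])
    · exact hJ.before K (hI.before K hK J (by simp)) _ h
    · exact hI.before K hK _ (by simp [h])

theorem refines_refineLeft (I : GapInterval α) : Refines (refineLeft I).val I := by
  have h := refines_splitAt ((I.size + 1) / 2) I
  simp only [refineLeft, Timed.bind]
  generalize (splitAt ((I.size + 1) / 2) I).val = l at h
  split
  · rename_i A B
    simpa [Timed.ret, Timed.bind] using
      Refines.replace_refines (P := [A]) (Q := []) h (refines_splitAt _ B)
  · exact h

theorem refines_refineRight (I : GapInterval α) : Refines (refineRight I).val I := by
  have h := refines_splitAt (I.size / 2) I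
  simp only [refineRight, Timed.bind]
  generalize (splitAt (I.size / 2) I).val = l at h
  split
  · rename_i A B
    simpa [Timed.ret, Timed.bind] using
      Refines.replace_refines (P := []) (Q := [B]) h (refines_splitAt _ A)
  · exact h

/-! ### Locating an element among the intervals. -/

theorem bsearch_spec (r : ℕ → WithTop α) (x : α) (lo len : ℕ)
    (hr : ∀ i j, i ≤ j → j < lo + len → r i ≤ r j) :
    (bsearch r x lo len).val ≤ lo + len ∧
    (∀ k, lo ≤ k → k < (bsearch r x lo len).val → r k < x) ∧
    ((bsearch r x lo len).val < lo + len → (x : WithTop α) ≤ r (bsearch r x lo len).val) := by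
  induction len using Nat.strong_induction_on generalizing lo with
  | _ len ih =>
    rw [bsearch]
    split_ifs with h h'
    · subst h; simp only [Timed.ret]; exact ⟨le_rfl, fun k _ _ => by omega, fun _ => by omega⟩
    · obtain ⟨h1, h2, h3⟩ := ih (len / 2) (by omega) lo fun i j hij hj => hr i j hij (by omega)
      simp only [Timed.tick]
      refine ⟨by omega, h2, fun _ => ?_⟩
      -- The search in the lower half may return its upper end `lo + len / 2`, which is the index
      -- just tested.
      rcases h1.lt_or_eq with hlt | heq
      · exact h3 hlt
      · rwa [heq]
    · obtain ⟨h1, h2, h3⟩ := ih (len - len / 2 - 1) (by omega) (lo + len / 2 + 1)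
        fun i j hij hj => hr i j hij (by omega)
      simp only [Timed.tick]
      refine ⟨by omega, fun k hk hk' => ?_, fun h4 => h3 (by omega)⟩
      rcases Nat.lt_or_ge (lo + len / 2) k with hlt | hge
      · exact h2 k hlt hk'
      · exact (hr k _ hge (by omega)).trans_lt (not_le.1 h')

theorem find_spec (x : α) {l : List (GapInterval α)} (hl : Sorted l) (hne : l ≠ []) :
    ∃ P I Q, l = P ++ I :: Q ∧ (find x l).val = P.length ∧
      (∀ J ∈ P, J.router < (x : WithTop α)) ∧ (Q ≠ [] → (x : WithTop α) ≤ I.router) := by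
  have hpos := List.length_pos_of_ne_nil hne
  have hget : ∀ i (hi : i < l.length), (l.map router).getD i ⊤ = l[i].router := by
    intro i hi; simp [List.getD, hi]
  have hmono : ∀ i j, i ≤ j → j < 0 + (l.length - 1) →
      (l.map router).getD i ⊤ ≤ (l.map router).getD j ⊤ := by
    intro i j hij hj
    rcases hij.lt_or_eq with hij | rfl
    · rw [hget i (by omega), hget j (by omega)]
      have h1 := List.pairwise_iff_getElem.1 hl.1 i j (by omega) (by omega) hij
      -- The last router is excluded from the search, so `j` has a successor, and this bounds the
      -- elements of `l[j]` by its router; any such element then separates the two routers.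
      have h2 := List.pairwise_iff_getElem.1 hl.1 j (l.length - 1) (by omega) (by omega) (by omega)
      obtain ⟨z, hz⟩ := List.exists_mem_of_ne_nil _ (hl.2 l[j] (List.getElem_mem _))
      exact (h1.2 z hz).le.trans (h2.1 z hz)
    · exact le_rfl
  obtain ⟨h1, h2, h3⟩ := bsearch_spec (fun i => (l.map router).getD i ⊤) x 0 (l.length - 1) hmono
  change (find x l).val ≤ _ at h1
  change ∀ k, _ → k < (find x l).val → _ at h2
  change (find x l).val < _ → _ ≤ (l.map router).getD (find x l).val ⊤ at h3
  generalize (find x l).val = j at *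
  have hj : j < l.length := by omega
  refine ⟨l.take j, l[j], l.drop (j + 1), by simp, by simp; omega, fun J hJ => ?_, fun hQ => ?_⟩
  · obtain ⟨k, hk, rfl⟩ := List.mem_take_iff_getElem.1 hJ
    simpa only [hget k (by omega)] using h2 k (by omega) (by omega)
  · rw [ne_eq, List.drop_eq_nil_iff] at hQ
    rw [← hget j hj]
    exact h3 (by omega)

/-- Adding an element to the interval into which it falls. -/
theorem Sorted.insert {P Q : List (GapInterval α)} {I : GapInterval α} {x : α}
    (h : Sorted (P ++ I :: Q)) (hP : ∀ J ∈ P, J.router < (x : WithTop α))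
    (hQ : Q ≠ [] → (x : WithTop α) ≤ I.router) :
    Sorted (P ++ ⟨I.router, x :: I.elems⟩ :: Q) := by
  obtain ⟨h1, h2⟩ := h
  simp only [List.pairwise_append, List.pairwise_cons, List.mem_cons, forall_eq_or_imp] at h1
  obtain ⟨hP', ⟨hIQ, hQ'⟩, hPQ⟩ := h1
  refine ⟨?_, fun K hK => ?_⟩
  · simp only [List.pairwise_append, List.pairwise_cons, List.mem_cons, forall_eq_or_imp]
    refine ⟨hP', ⟨fun K hK => ⟨?_, (hIQ K hK).2⟩, hQ'⟩, fun K hK => ⟨⟨(hPQ K hK).1.1, ?_⟩,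
      (hPQ K hK).2⟩⟩
    · simpa using And.intro (hQ (List.ne_nil_of_mem hK)) (hIQ K hK).1
    · simpa using And.intro (hP K hK) (hPQ K hK).1.2
  · simp only [List.mem_append, List.mem_cons] at hK
    rcases hK with hK | rfl | hK
    · exact h2 K (by simp [hK])
    · simp
    · exact h2 K (by simp [hK])

/-! ### Dividing a gap at an element. -/

section Division

variable {P Q : List (GapInterval α)} {I : GapInterval α} {x : α}

theorem Sorted.content_left_le (h : Sorted (P ++ I :: Q))
    (hP : ∀ J ∈ P, J.router < (x : WithTop α)) : ∀ y ∈ content P, y < x := by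
  intro y hy
  obtain ⟨J, hJ, hy⟩ := List.mem_flatMap.1 hy
  have := (List.pairwise_append.1 h.1).2.2 J hJ I (by simp)
  exact WithTop.coe_lt_coe.1 ((this.1 y hy).trans_lt (hP J hJ))

theorem Sorted.lt_content_right (h : Sorted (P ++ I :: Q))
    (hQ : Q ≠ [] → (x : WithTop α) ≤ I.router) : ∀ y ∈ content Q, x < y := by
  intro y hy
  obtain ⟨J, hJ, hy⟩ := List.mem_flatMap.1 hy
  have := (List.pairwise_cons.1 (List.pairwise_append.1 h.1).2.1).1 J hJ
  exact WithTop.coe_lt_coe.1 ((hQ (List.ne_nil_of_mem hJ)).trans_lt (this.2 y hy))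

/-- Everything in `P` is below `x` and everything in `Q` above it. Hence the failure branch of
`LST.query` is never taken for an element present in the gap. -/
theorem Sorted.mem_of_mem_content (h : Sorted (P ++ I :: Q))
    (hP : ∀ J ∈ P, J.router < (x : WithTop α)) (hQ : Q ≠ [] → (x : WithTop α) ≤ I.router)
    (hx : x ∈ content (P ++ I :: Q)) : x ∈ I.elems := by
  simp only [content_append, content_cons, List.mem_append] at hx
  rcases hx with hx | hx | hx
  · exact absurd (h.content_left_le hP x hx) (lt_irrefl x)
  · exact hx
  · exact absurd (h.lt_content_right hQ x hx) (lt_irrefl x)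

/-- Only `I` can contain elements on both sides of `x`, so partitioning this one interval partitions
the whole gap. -/
theorem Sorted.divide_left (h : Sorted (P ++ I :: Q))
    (hP : ∀ J ∈ P, J.router < (x : WithTop α)) (hQ : Q ≠ [] → (x : WithTop α) ≤ I.router)
    {L : List (GapInterval α)} (hL : Refines L ⟨(x : WithTop α), I.elems.filter (· ≤ x)⟩) :
    Sorted (P ++ L) ∧ (content (P ++ L)).Perm ((content (P ++ I :: Q)).filter (· ≤ x)) := by
  constructor
  · have h1 := h.1
    simp only [List.pairwise_append, List.pairwise_cons, List.mem_cons, forall_eq_or_imp] at h1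
    have := hL.replace (P := P) (Q := []) ?_ fun J hJ => h.2 J (by simp_all)
    · simpa using this
    · simp only [List.pairwise_append, List.pairwise_cons, List.mem_cons, List.not_mem_nil,
        or_false, forall_eq]
      exact ⟨h1.1, by simp, fun K hK => ⟨(h1.2.2 K hK).1.1,
        fun y hy => (h1.2.2 K hK).1.2 y (List.mem_filter.1 hy).1⟩⟩
  · have e1 : (content P).filter (· ≤ x) = content P := by
      simpa [List.filter_eq_self] using fun y hy => (h.content_left_le hP y hy).le
    have e2 : (content Q).filter (· ≤ x) = [] := by
      simpa [List.filter_eq_nil_iff] using h.lt_content_right hQ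
    simp only [content_append, content_cons, List.filter_append, e1, e2, List.append_nil]
    exact hL.perm.append_left _

theorem Sorted.divide_right (h : Sorted (P ++ I :: Q))
    (hP : ∀ J ∈ P, J.router < (x : WithTop α)) (hQ : Q ≠ [] → (x : WithTop α) ≤ I.router)
    {L : List (GapInterval α)} (hL : Refines L ⟨I.router, I.elems.filter (x < ·)⟩) :
    Sorted (L ++ Q) ∧ (content (L ++ Q)).Perm ((content (P ++ I :: Q)).filter (x < ·)) := by
  constructor
  · have h1 := h.1
    simp only [List.pairwise_append, List.pairwise_cons, List.mem_cons, forall_eq_or_imp] at h1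
    refine hL.replace (P := []) (Q := Q) ?_ fun J hJ => h.2 J (by simp_all)
    simp only [List.nil_append, List.pairwise_cons]
    exact ⟨fun K hK => ⟨fun y hy => (h1.2.1.1 K hK).1 y (List.mem_filter.1 hy).1,
      (h1.2.1.1 K hK).2⟩, h1.2.1.2⟩
  · have e1 : (content P).filter (x < ·) = [] := by
      simpa [List.filter_eq_nil_iff] using fun y hy => (h.content_left_le hP y hy).le
    have e2 : (content Q).filter (x < ·) = content Q := by
      simpa [List.filter_eq_self] using h.lt_content_right hQ
    simp only [content_append, content_cons, List.filter_append, e1, e2, List.nil_append]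
    exact hL.perm.append_right _

end Division

theorem Sorted.isEmpty_iff {l : List (GapInterval α)} (h : Sorted l) :
    l.isEmpty = true ↔ content l = [] := by
  rw [List.isEmpty_iff]
  refine ⟨fun e => by simp [e, content], fun e => ?_⟩
  rcases l with _ | ⟨I, l⟩
  · rfl
  · exact absurd (List.append_eq_nil_iff.1 (content_cons I l ▸ e)).1 (h.2 I (by simp))

end GapInterval

/-! ### Gaps determined by the set of accessed elements. -/

namespace GapRun

variable {α : Type u} [LinearOrder α]

theorem le_boundary (A : Finset α) (y : α) : (y : WithTop α) ≤ boundary A y :=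
  Finset.le_min fun _ ha => WithTop.coe_le_coe.2 (Finset.mem_filter.1 ha).2

theorem boundary_le {A : Finset α} {y a : α} (ha : a ∈ A) (hy : y ≤ a) :
    boundary A y ≤ (a : WithTop α) :=
  Finset.min_le (Finset.mem_filter.2 ⟨ha, hy⟩)

theorem boundary_of_mem {A : Finset α} {a : α} (ha : a ∈ A) : boundary A a = a :=
  le_antisymm (boundary_le ha le_rfl) (le_boundary A a)

theorem mem_of_boundary_eq {A : Finset α} {y a : α} (h : boundary A y = a) : a ∈ A :=
  (Finset.mem_filter.1 (Finset.mem_of_min h)).1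

theorem boundary_mono (A : Finset α) {y z : α} (h : y ≤ z) : boundary A y ≤ boundary A z :=
  Finset.min_mono fun _ ha => Finset.mem_filter.2
    ⟨(Finset.mem_filter.1 ha).1, h.trans (Finset.mem_filter.1 ha).2⟩

/-- The hypothesis says that no accessed element lies in `[y, z)`, so both points have the same
accessed elements above them. -/
theorem boundary_eq_of_le {A : Finset α} {y z : α} (h : y ≤ z)
    (hz : (z : WithTop α) ≤ boundary A y) : boundary A y = boundary A z := by
  refine le_antisymm (boundary_mono A h) ?_
  cases hb : boundary A y with
  | top => exact le_top
  | coe a =>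
    rw [hb] at hz
    exact boundary_le (mem_of_boundary_eq hb) (WithTop.coe_le_coe.1 hz)

theorem boundary_insert (A : Finset α) (x y : α) :
    boundary (Insert.insert x A) y = if y ≤ x then min (x : WithTop α) (boundary A y)
      else boundary A y := by
  unfold boundary
  rw [Finset.filter_insert]
  split_ifs <;> simp [Finset.min_insert]

/-- With the next two lemmas: a new boundary `x` cuts the gap of `x` into its parts up to `x` and
beyond `x`, and leaves every other gap alone. -/
theorem boundary_insert_eq_self_iff {A : Finset α} {x y : α} (hx : x ∉ A) :
    boundary (Insert.insert x A) y = x ↔ boundary A y = boundary A x ∧ y ≤ x := by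
  rw [boundary_insert]
  split_ifs with h
  · simp only [min_eq_left_iff, h, and_true]
    exact ⟨boundary_eq_of_le h, fun e => e ▸ le_boundary A x⟩
  · exact iff_of_false (fun e => hx (mem_of_boundary_eq e)) fun e => h e.2

theorem boundary_insert_eq_boundary_iff {A : Finset α} {x y : α} (hx : x ∉ A) :
    boundary (Insert.insert x A) y = boundary A x ↔ boundary A y = boundary A x ∧ x < y := by
  have hlt : (x : WithTop α) < boundary A x :=
    lt_of_le_of_ne (le_boundary A x) fun e => hx (mem_of_boundary_eq e.symm)
  rw [boundary_insert]
  split_ifs with h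
  · exact iff_of_false (fun e => (((min_le_left _ _).trans_lt hlt).ne e)) fun e => e.2.not_ge h
  · simp [not_le.1 h]

theorem boundary_insert_eq_of_ne {A : Finset α} {x y : α} {c : WithTop α}
    (hc : c ≠ x) (hc' : c ≠ boundary A x) :
    boundary (Insert.insert x A) y = c ↔ boundary A y = c := by
  rw [boundary_insert]
  split_ifs with h
  · rcases le_total (x : WithTop α) (boundary A y) with h' | h'
    · rw [min_eq_left h']
      exact iff_of_false hc.symm fun e => hc' (e ▸ boundary_eq_of_le h h')
    · rw [min_eq_right h']
  · rfl

theorem gapSize_eq_length_filter (E : List α) (A : Finset α) (b : WithTop α) :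
    gapSize E A b = (E.filter fun y => boundary A y = b).length :=
  List.countP_eq_length_filter

theorem gapSize_ne_zero {E : List α} {A : Finset α} {b : WithTop α} :
    gapSize E A b ≠ 0 ↔ ∃ y ∈ E, boundary A y = b := by
  simp [gapSize]

theorem gapSize_cons (x : α) (E : List α) (A : Finset α) (b : WithTop α) :
    gapSize (x :: E) A b = gapSize E A b + if boundary A x = b then 1 else 0 := by
  simp [gapSize, List.countP_cons]

theorem gapSize_of_notMem (E : List α) {A : Finset α} {x : α} (hx : x ∉ A) :
    gapSize E A x = 0 :=
  not_not.1 fun h => by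
    obtain ⟨y, -, hy⟩ := gapSize_ne_zero.1 h
    exact hx (mem_of_boundary_eq hy)

end GapRun

/-! ### The coupling invariant. -/

open GapInterval GapRun

variable {α : Type u} [LinearOrder α] {D : GapDS.{u, v} α}

/-- `g` represents the gap with right boundary `b` when the elements `E` are present and those
of `A` have been accessed. -/
structure Gap.Represents (g : Gap α) (E : List α) (A : Finset α) (b : WithTop α) : Prop where
  last : ∀ a, g.last = some a ↔ b = a
  sorted : Sorted g.intervals
  perm : (content g.intervals).Perm (E.filter fun y => boundary A y = b)

/-- The lazy search tree `T` and the gap data structure on its own are in the same state, and the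
second level of `T` represents the gaps. -/
structure LST.Agree (T : LST D) (G : GapRun D) : Prop where
  gaps : T.gaps = G.state
  mem : ∀ a ∈ G.accessed, a ∈ G.elems
  size : ∀ b, D.size T.gaps b = gapSize G.elems G.accessed b
  gap : ∀ b, gapSize G.elems G.accessed b ≠ 0 →
    (T.gap b).Represents G.elems G.accessed b

theorem Gap.Represents.exists_find {g : Gap α} {E : List α} {A : Finset α} {b : WithTop α}
    (h : g.Represents E A b) (hb : gapSize E A b ≠ 0) (x : α) :
    ∃ P I Q, g.intervals = P ++ I :: Q ∧ (find x g.intervals).val = P.length ∧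
      (∀ J ∈ P, J.router < (x : WithTop α)) ∧ (Q ≠ [] → (x : WithTop α) ≤ I.router) := by
  refine find_spec x h.sorted fun e => hb ?_
  have := h.perm.length_eq
  rw [gapSize_eq_length_filter, ← this, e]
  rfl

/-! ### Every operation preserves the invariant. -/

namespace LST.Agree

variable {T : LST D} {G : GapRun D}

theorem construct (D : GapDS.{u, v} α) (S : List α) :
    (LST.construct D S).val.Agree (GapRun.construct D S).val := by
  have hb : ∀ y : α, boundary ∅ y = ⊤ := fun y => by simp [boundary]
  refine ⟨rfl, by simp [GapRun.construct, Timed.bind, Timed.ret], fun b => ?_, fun b hbS => ?_⟩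
  · simp only [LST.construct, GapRun.construct, Timed.bind, Timed.tick, Timed.ret]
    rcases S with _ | ⟨d, S⟩
    · simp [D.size_empty, gapSize]
    · simp only [List.isEmpty_cons, Bool.false_eq_true, if_false]
      rw [D.size_add _ _ _ (D.size_empty _) (by simp)]
      by_cases h : b = ⊤
      · simp [h, gapSize, hb]
      · simp [h, gapSize, hb, D.size_empty, Ne.symm h]
  · simp only [GapRun.construct, Timed.bind, Timed.ret] at hbS
    obtain ⟨y, hy, rfl⟩ := gapSize_ne_zero.1 hbS
    simp only [LST.construct, GapRun.construct, Timed.bind, Timed.tick, Timed.ret, hb]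
    exact ⟨by simp, by simpa [Sorted] using List.ne_nil_of_mem hy, by simp [content, hb]⟩

/-- `D` sees only nonempty gaps, while `boundary` ignores sizes. The two can disagree only if the
gap of `x` is empty, and then nothing is located at all. -/
theorem locate_eq_some_iff (h : T.Agree G) (x : α) (b : WithTop α) :
    (D.locate x T.gaps).val.2 = some b ↔
      b = boundary G.accessed x ∧ gapSize G.elems G.accessed b ≠ 0 := by
  rw [D.locate_eq_some]
  have key : gapSize G.elems G.accessed (boundary G.accessed x) ≠ 0 →
      IsLeast {c : WithTop α | D.size T.gaps c ≠ 0 ∧ (x : WithTop α) ≤ c}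
        (boundary G.accessed x) := by
    refine fun h0 => ⟨⟨by rwa [h.size], le_boundary _ _⟩, fun c hc => ?_⟩
    obtain ⟨hc, hxc⟩ := hc
    rw [h.size] at hc
    obtain ⟨y, -, rfl⟩ := gapSize_ne_zero.1 hc
    rcases le_total y x with hyx | hxy
    · exact (boundary_eq_of_le hyx hxc).ge
    · exact boundary_mono _ hxy
  constructor
  · intro hb
    have h0 : gapSize G.elems G.accessed b ≠ 0 := by simpa [h.size] using hb.1.1
    suffices gapSize G.elems G.accessed (boundary G.accessed x) ≠ 0 from
      ⟨hb.unique (key this), h0⟩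
    -- A finite boundary is itself an element of its gap, by `h.mem`. If the boundary is `⊤`, the
    -- element `y` that witnesses the located gap must also have boundary `⊤`.
    cases hc : boundary G.accessed x with
    | coe a =>
      have ha := mem_of_boundary_eq hc
      exact gapSize_ne_zero.2 ⟨a, h.mem a ha, boundary_of_mem ha⟩
    | top =>
      obtain ⟨y, -, hy⟩ := gapSize_ne_zero.1 h0
      rcases le_total y x with hyx | hxy
      · rwa [← hc, ← boundary_eq_of_le hyx (hy ▸ hb.1.2), hy]
      · rwa [← top_le_iff.1 (hc ▸ boundary_mono G.accessed hxy), hy]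
  · rintro ⟨rfl, h0⟩
    exact key h0

/-- Every finite boundary was accessed and is still present, so only the unbounded gap can be empty.
-/
theorem locate_eq_none (h : T.Agree G) {x : α}
    (h0 : gapSize G.elems G.accessed (boundary G.accessed x) = 0) :
    (D.locate x T.gaps).val.2 = none ∧ boundary G.accessed x = ⊤ := by
  constructor
  · rw [Option.eq_none_iff_forall_ne_some]
    intro b hb
    obtain ⟨rfl, hb⟩ := (h.locate_eq_some_iff x b).1 hb
    exact hb h0
  · by_contra hne
    obtain ⟨a, ha⟩ := WithTop.ne_top_iff_exists.1 hne
    have hmem := mem_of_boundary_eq ha.symm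
    exact gapSize_ne_zero.2 ⟨a, h.mem a hmem, (boundary_of_mem hmem).trans ha⟩ h0

/-- The tree branches on the outcome of `locate`, the run on its own on emptiness of the gap; by the
two preceding lemmas these tests agree, and so do the calls to `D`. -/
theorem insert (h : T.Agree G) (x : α) : (T.insert x).val.Agree (G.insert x).val := by
  by_cases h0 : gapSize G.elems G.accessed (boundary G.accessed x) = 0
  · obtain ⟨hl, htop⟩ := h.locate_eq_none h0
    have hT : (T.insert x).val = ⟨(D.add ⊤ 1 (D.locate x T.gaps).val.1).val,
        Function.update T.gap ⊤ ⟨[⟨⊤, [x]⟩], none, decide (0 < T.count)⟩, T.count + 1⟩ := by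
      simp [LST.insert, Timed.bind, Timed.ret, Timed.tick, hl]
    have hG : (G.insert x).val = ⟨(D.add ⊤ 1 (D.locate x T.gaps).val.1).val, x :: G.elems,
        G.accessed⟩ := by
      rw [htop] at h0
      simp only [GapRun.insert, Timed.bind, Timed.ret, htop, if_pos h0, ← h.gaps]
    rw [hT, hG]
    rw [htop] at h0
    refine ⟨rfl, fun a ha => List.mem_cons_of_mem _ (h.mem a ha), fun b => ?_, fun b hb => ?_⟩
    · dsimp only
      rw [D.size_add _ _ _ (by rw [D.size_locate, h.size, h0]) one_pos, D.size_locate,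
        gapSize_cons, htop]
      by_cases hb : b = ⊤
      · simp [hb, h0]
      · simp [hb, h.size, Ne.symm hb]
    · dsimp only at hb ⊢
      by_cases hbt : b = ⊤
      · subst hbt
        rw [Function.update_self]
        have he : G.elems.filter (fun y => boundary G.accessed y = ⊤) = [] :=
          List.length_eq_zero_iff.1 ((gapSize_eq_length_filter _ _ _).symm.trans h0)
        exact ⟨by simp, by simp [Sorted], by simp [content, htop, he]⟩
      · rw [Function.update_of_ne hbt]
        have hb' : boundary G.accessed x ≠ b := htop ▸ Ne.symm hbt
        rw [gapSize_cons, if_neg hb'] at hb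
        obtain ⟨h1, h2, h3⟩ := h.gap b hb
        exact ⟨h1, h2, by simpa [hb'] using h3⟩
  · obtain ⟨h1, h2, h3⟩ := h.gap _ h0
    obtain ⟨P, I, Q, hl, hf, hP, hQ⟩ := (h.gap _ h0).exists_find h0 x
    have hloc := (h.locate_eq_some_iff x _).2 ⟨rfl, h0⟩
    have hT : (T.insert x).val =
        ⟨(D.increment (boundary G.accessed x) (D.locate x T.gaps).val.1).val,
        Function.update T.gap (boundary G.accessed x) { T.gap (boundary G.accessed x) with
          intervals := P ++ ⟨I.router, x :: I.elems⟩ :: Q }, T.count + 1⟩ := by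
      have hmod : (P ++ I :: Q).modify P.length (fun I => { I with elems := x :: I.elems }) =
          P ++ ⟨I.router, x :: I.elems⟩ :: Q := by
        simp [List.modify_eq_take_cons_drop (l := P ++ I :: Q) (i := P.length)]
      simp only [LST.insert, Timed.bind, Timed.ret, Timed.tick, hloc, hf]
      rw [hl, hmod]
    have hG : (G.insert x).val =
        ⟨(D.increment (boundary G.accessed x) (D.locate x T.gaps).val.1).val, x :: G.elems,
        G.accessed⟩ := by
      simp only [GapRun.insert, Timed.bind, Timed.ret, if_neg h0, ← h.gaps]
    rw [hT, hG]
    refine ⟨rfl, fun a ha => List.mem_cons_of_mem _ (h.mem a ha), fun b => ?_, fun b hb => ?_⟩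
    · dsimp only
      rw [D.size_increment _ _ (by rwa [D.size_locate, h.size]), D.size_locate, gapSize_cons]
      by_cases hb : b = boundary G.accessed x
      · simp [hb, h.size]
      · simp [hb, h.size, Ne.symm hb]
    · dsimp only at hb ⊢
      by_cases hbt : b = boundary G.accessed x
      · subst hbt
        rw [Function.update_self]
        rw [hl] at h2 h3
        refine ⟨h1, h2.insert hP hQ, ?_⟩
        simp only [List.filter_cons, decide_true, if_true]
        refine List.Perm.trans ?_ (h3.cons x)
        simp only [content_append, content_cons, List.cons_append]
        exact List.perm_middle
      · rw [Function.update_of_ne hbt]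
        rw [gapSize_cons, if_neg (Ne.symm hbt)] at hb
        obtain ⟨h1, h2, h3⟩ := h.gap b hb
        exact ⟨h1, h2, by simpa [Ne.symm hbt] using h3⟩

/-- A repeated access only locates the gap. -/
theorem access_of_mem (h : T.Agree G) {x : α} (hx : x ∈ G.accessed) :
    T.access x = ⟨(⟨(D.locate x G.state).val.1, T.gap, T.count⟩, some x),
      (D.locate x G.state).time + 2⟩ := by
  have h0 : gapSize G.elems G.accessed x ≠ 0 :=
    gapSize_ne_zero.2 ⟨x, h.mem x hx, boundary_of_mem hx⟩
  have hloc := (h.locate_eq_some_iff x _).2 ⟨(boundary_of_mem hx).symm, h0⟩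
  have hlast := ((h.gap _ h0).last x).2 rfl
  simp [LST.access, Timed.bind, Timed.ret, Timed.tick, hloc, hlast, ← h.gaps]

theorem run_access_of_mem {x : α} (hx : x ∈ G.accessed) :
    G.access x = ⟨⟨(D.locate x G.state).val.1, G.elems, G.accessed⟩,
      (D.locate x G.state).time⟩ := by
  simp [GapRun.access, Timed.bind, Timed.ret, hx]

/-- Isolates what the coupling needs from a first access: the new interval lists enter only through
their order and content, and `c` is already written as a sequence of calls to `D`. -/
theorem query (h : T.Agree G) {x : α} (hx : x ∈ G.elems) (hxA : x ∉ G.accessed) :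
    ∃ A B c, Sorted A ∧ Sorted B ∧
      (content A).Perm (G.elems.filter fun y => boundary (Insert.insert x G.accessed) y = x) ∧
      (content B).Perm (G.elems.filter fun y =>
        boundary (Insert.insert x G.accessed) y = boundary G.accessed x) ∧
      (T.access x).val.1 = ⟨c, Function.update (Function.update T.gap (boundary G.accessed x)
        ⟨B, (T.gap (boundary G.accessed x)).last, true⟩) (x : WithTop α)
          ⟨A, some x, (T.gap (boundary G.accessed x)).leftQuery⟩, T.count⟩ ∧
      c = (let s := (D.add (x : WithTop α) (total A) (D.remove (boundary G.accessed x)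
          (D.locate x G.state).val.1).val).val
        if B.isEmpty then s else (D.add (boundary G.accessed x) (total B) s).val) := by
  have h0 : gapSize G.elems G.accessed (boundary G.accessed x) ≠ 0 :=
    gapSize_ne_zero.2 ⟨x, hx, rfl⟩
  have hloc := (h.locate_eq_some_iff x _).2 ⟨rfl, h0⟩
  have hlast : (T.gap (boundary G.accessed x)).last ≠ some x := fun e =>
    hxA (mem_of_boundary_eq (((h.gap _ h0).last x).1 e))
  obtain ⟨h1, h2, h3⟩ := h.gap _ h0
  obtain ⟨P, I, Q, hl, hf, hP, hQ⟩ := (h.gap _ h0).exists_find h0 x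
  rw [hl] at h2 h3
  have hxI : x ∈ I.elems := h2.mem_of_mem_content hP hQ
    (h3.mem_iff.2 (List.mem_filter.2 ⟨hx, by simp⟩))
  obtain ⟨hA, hA'⟩ := h2.divide_left hP hQ
    (refines_refineLeft ⟨(x : WithTop α), I.elems.filter (· ≤ x)⟩)
  obtain ⟨hB, hB'⟩ := h2.divide_right hP hQ
    (refines_refineRight ⟨I.router, I.elems.filter (x < ·)⟩)
  -- The witnesses `A` and `B` are read off from the two `sorted_rebalance` terms, and `c` from the
  -- final `rfl`.
  refine ⟨_, _, _, sorted_rebalance (T.gap (boundary G.accessed x)).leftQuery true hA,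
    sorted_rebalance true (decide (boundary G.accessed x ≠ ⊤)) hB, ?_, ?_, ?_, rfl⟩
  · rw [content_rebalance]
    refine hA'.trans ((h3.filter _).trans (.of_eq ?_))
    rw [List.filter_filter]
    exact List.filter_congr fun y _ => by
      simp [boundary_insert_eq_self_iff hxA, Bool.and_comm]
  · rw [content_rebalance]
    refine hB'.trans ((h3.filter _).trans (.of_eq ?_))
    rw [List.filter_filter]
    exact List.filter_congr fun y _ => by
      simp [boundary_insert_eq_boundary_iff hxA, Bool.and_comm]
  · have hj : (T.gap (boundary G.accessed x)).intervals.getD P.length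
        ⟨boundary G.accessed x, []⟩ = I := by simp [hl]
    have ht : (T.gap (boundary G.accessed x)).intervals.take P.length = P := by simp [hl]
    have hd : (T.gap (boundary G.accessed x)).intervals.drop (P.length + 1) = Q := by simp [hl]
    have hmem : x ∈ I.elems.filter (· ≤ x) := by simp [hxI]
    simp only [LST.access, LST.query, Timed.bind, Timed.tick, hloc, if_neg hlast, hf, hj, ht, hd,
      GapInterval.partition, Timed.ret, if_pos hmem, ← h.gaps]
    split_ifs <;> rfl

theorem access (h : T.Agree G) {x : α} (hx : x ∈ G.elems) :
    (T.access x).val.1.Agree (G.access x).val := by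
  by_cases hxA : x ∈ G.accessed
  · rw [h.access_of_mem hxA, run_access_of_mem hxA]
    exact ⟨rfl, h.mem, fun b => by simpa [D.size_locate, ← h.gaps] using h.size b, h.gap⟩
  · obtain ⟨A, B, c, hA, hB, hA', hB', hT, hc⟩ := h.query hx hxA
    have h0 : gapSize G.elems G.accessed (boundary G.accessed x) ≠ 0 :=
      gapSize_ne_zero.2 ⟨x, hx, rfl⟩
    have hne : boundary G.accessed x ≠ x := fun e => hxA (mem_of_boundary_eq e)
    have htA : total A = gapSize G.elems (Insert.insert x G.accessed) x := by
      rw [total_eq_length_content, hA'.length_eq, gapSize_eq_length_filter]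
    have htB : total B = gapSize G.elems (Insert.insert x G.accessed) (boundary G.accessed x) := by
      rw [total_eq_length_content, hB'.length_eq, gapSize_eq_length_filter]
    have heB : B.isEmpty = true ↔
        gapSize G.elems (Insert.insert x G.accessed) (boundary G.accessed x) = 0 := by
      rw [hB.isEmpty_iff, ← htB, total_eq_length_content, List.length_eq_zero_iff]
    -- Once the totals and the emptiness test are expressed by `gapSize`, the calls to `D` are
    -- literally those of `GapRun.access`.
    rw [htA, htB] at hc
    simp only [heB] at hc
    have hG : (G.access x).val = ⟨c, G.elems, Insert.insert x G.accessed⟩ := by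
      rw [hc]
      simp only [GapRun.access, Timed.bind, if_neg hxA, Timed.ret]
      split_ifs <;> rfl
    have hpos : 0 < gapSize G.elems (Insert.insert x G.accessed) x :=
      Nat.pos_of_ne_zero (gapSize_ne_zero.2 ⟨x, hx, boundary_of_mem (Finset.mem_insert_self _ _)⟩)
    have hother : ∀ b, b ≠ (x : WithTop α) → b ≠ boundary G.accessed x →
        ∀ y, boundary (Insert.insert x G.accessed) y = b ↔ boundary G.accessed y = b :=
      fun b hb hb' y => boundary_insert_eq_of_ne hb hb'
    have hother' : ∀ b, b ≠ (x : WithTop α) → b ≠ boundary G.accessed x →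
        gapSize G.elems (Insert.insert x G.accessed) b = gapSize G.elems G.accessed b :=
      fun b hb hb' => by simp only [gapSize, hother b hb hb']
    have hsize : D.size c = gapSize G.elems (Insert.insert x G.accessed) := by
      have hs : D.size (D.add (x : WithTop α)
          (gapSize G.elems (Insert.insert x G.accessed) x) (D.remove (boundary G.accessed x)
            (D.locate x G.state).val.1).val).val =
          Function.update (Function.update (gapSize G.elems G.accessed) (boundary G.accessed x) 0) x
            (gapSize G.elems (Insert.insert x G.accessed) x) := by
        have hg : D.size (D.locate x G.state).val.1 = gapSize G.elems G.accessed := by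
          rw [D.size_locate, ← h.gaps]
          exact funext h.size
        have hr := D.size_remove (boundary G.accessed x) (D.locate x G.state).val.1 (by rwa [hg])
        rw [hg] at hr
        rw [D.size_add _ _ _ _ hpos, hr]
        -- `D.add` requires that no gap ends at `x` yet, which holds since `x` was not accessed
        -- before.
        rw [hr, Function.update_of_ne hne.symm, gapSize_of_notMem _ hxA]
      rw [hc]
      split_ifs with hz
      · rw [hs]
        funext b
        by_cases hb : b = x
        · simp [hb]
        by_cases hb' : b = boundary G.accessed x
        · simp [hb', hne, hz]
        · simp [hb, hb', hother' b hb hb']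
      · rw [D.size_add _ _ _ (by rw [hs]; simp [hne]) (Nat.pos_of_ne_zero hz), hs]
        funext b
        by_cases hb' : b = boundary G.accessed x
        · simp [hb']
        by_cases hb : b = x
        · simp [hb, hne.symm]
        · simp [hb, hb', hother' b hb hb']
    rw [hT, hG]
    refine ⟨rfl, fun a ha => ?_, fun b => congrFun hsize b, fun b hb => ?_⟩
    · exact (Finset.mem_insert.1 ha).elim (fun e => e ▸ hx) (h.mem a)
    · dsimp only at hb ⊢
      by_cases hbx : b = x
      · subst hbx
        rw [Function.update_self]
        exact ⟨fun a => by simp, hA, hA'⟩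
      rw [Function.update_of_ne hbx]
      by_cases hbb : b = boundary G.accessed x
      · subst hbb
        rw [Function.update_self]
        -- The right part keeps the old right boundary, hence also the old `last`.
        exact ⟨(h.gap _ h0).last, hB, hB'⟩
      · rw [Function.update_of_ne hbb]
        rw [hother' b hbx hbb] at hb
        obtain ⟨h1, h2, h3⟩ := h.gap b hb
        exact ⟨h1, h2, by simpa only [hother b hbx hbb] using h3⟩

end LST.Agree

namespace GapRun

theorem access_elems (G : GapRun D) (x : α) : (G.access x).val.elems = G.elems := by
  simp only [GapRun.access, Timed.bind]
  split_ifs <;> rfl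

theorem access_accessed (G : GapRun D) (x : α) :
    (G.access x).val.accessed = Insert.insert x G.accessed := by
  simp only [GapRun.access, Timed.bind]
  split_ifs with h
  · exact (Finset.insert_eq_self.2 h).symm
  all_goals rfl

end GapRun

/-! ### Operation sequences and the time bound. -/

namespace LST.Agree

theorem foldl {T : LST D} {G : GapRun D} (h : T.Agree G) {ops : List (Op α)} {xs : List α}
    (hlegal : Op.Legal G.elems (ops ++ xs.map Op.access)) :
    (ops.foldl (fun T o => (T.apply o).val) T).Agree
        (ops.foldl (fun G o => (G.apply o).val) G) ∧
      Op.Legal (ops.foldl (fun G o => (G.apply o).val) G).elems (xs.map Op.access) ∧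
      (ops.foldl (fun G o => (G.apply o).val) G).accessed = G.accessed ∪ Op.accessed ops := by
  induction ops generalizing T G with
  | nil => exact ⟨h, hlegal, by simp [Op.accessed]⟩
  | cons o ops ih =>
    cases o with
    | insert x => exact ih (h.insert x) hlegal
    | access x =>
      obtain ⟨hx, hlegal⟩ := hlegal
      obtain ⟨h1, h2, h3⟩ := ih (h.access hx) (by rwa [GapRun.access_elems])
      refine ⟨h1, h2, h3.trans ?_⟩
      simp [GapRun.access_accessed, Op.accessed]

/-- First accesses count for nothing on either side, yet they must still preserve the invariant for
the accesses that follow. -/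
theorem repeatTime_le {T : LST D} {G : GapRun D} (h : T.Agree G) {xs : List α}
    (hlegal : Op.Legal G.elems (xs.map Op.access)) :
    repeatTime LST.apply T G.accessed xs ≤
      repeatTime GapRun.apply G G.accessed xs + 2 * xs.length := by
  induction xs generalizing T G with
  | nil => simp [repeatTime]
  | cons x xs ih =>
    obtain ⟨hx, hlegal⟩ := hlegal
    have hrec := ih (h.access hx) (by rwa [GapRun.access_elems])
    rw [GapRun.access_accessed] at hrec
    -- The `2` is the pointer step and the comparison in `LST.access`.
    have htime : (if x ∈ G.accessed then (T.apply (.access x)).time else 0) ≤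
        (if x ∈ G.accessed then (G.apply (.access x)).time else 0) + 2 := by
      split_ifs with hxA
      · simp [LST.apply, GapRun.apply, Timed.bind, Timed.ret, h.access_of_mem hxA,
          run_access_of_mem hxA]
      · simp
    simp only [repeatTime, List.length_cons]
    change _ + repeatTime LST.apply (T.access x).val.1 _ _ ≤
      _ + repeatTime GapRun.apply (G.access x).val _ _ + _
    omega

end LST.Agree

theorem mainTheorem7 :
    ∃ C : ℕ, ∀ (α : Type u) [LinearOrder α] (D : GapDS.{u, v} α) (S : List α)
      (pre : List (Op α)) (xs : List α),
      Op.Legal S (pre ++ xs.map Op.access) →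
      repeatTime LST.apply (LST.after D S pre) (Op.accessed pre) xs ≤
        repeatTime GapRun.apply (GapRun.after D S pre) (Op.accessed pre) xs +
          C * xs.length := by
  refine ⟨2, fun α _ D S pre xs hlegal => ?_⟩
  obtain ⟨h, hl, hA⟩ := (LST.Agree.construct D S).foldl hlegal
  have hA' : (GapRun.after D S pre).accessed = Op.accessed pre :=
    hA.trans (Finset.empty_union _)
  rw [← hA']
  exact h.repeatTime_le hl
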